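/- Let $G$ be a locally compact (Hausdorff) group with left Haar measure $\mu$ and corresponding outer measure $\mu^*$; call a subset of $G$ measurable if it is Carathéodory measurable for $\mu^*$, and locally null if its intersection with every compact subset of $G$ has measure zero (every null set is locally null, and the two notions coincide when $G$ is $\sigma$-compact). Let $\mathcal A$ be a point-finite family of locally null (for instance, null) subsets of $G$, i.e. every point of $G$ belongs to only finitely many members of $\mathcal A$, and suppose that $|\mathcal A|\le 2^{\aleph_0}$. If the union $\bigcup\mathcal A$ is not locally null, then there is a subfamily $\mathcal B\subset\mathcal A$ whose union $\bigcup\mathcal B$ is not measurable. -/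

import Mathlib

/-- `A` is locally null for `μ`: its intersection with every compact set has (outer) measure zero.
Every set of measure zero is locally null, and in a `σ`-compact space the converse holds. -/
def IsLocallyNull {G : Type*} [TopologicalSpace G] [MeasurableSpace G]
    (μ : MeasureTheory.Measure G) (A : Set G) : Prop :=
  ∀ K : Set G, IsCompact K → μ (A ∩ K) = 0

/-- `A` is Haar measurable: it is Carathéodory measurable for the outer measure `μ*` that
corresponds to the Haar measure `μ`. -/
def IsHaarMeasurable {G : Type*} [MeasurableSpace G]
    (μ : MeasureTheory.Measure G) (A : Set G) : Prop :=
  μ.toOuterMeasure.IsCaratheodory A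

/-- A family of sets is point-finite: every point lies in only finitely many members. -/
def IsPointFinite {G : Type*} (𝒜 : Set (Set G)) : Prop :=
  ∀ x : G, {A ∈ 𝒜 | x ∈ A}.Finite

open MeasureTheory Set

universe u v

/-! Suppose every subfamily has a measurable union. Code the members by distinct reals and let `F x`
be the finite set of codes of members containing `x`. On a compact `K`, the points where `F` meets
any given set of reals form a measurable set, so `f = min F` has measurable preimages of all sets of
reals, with null fibres. By Lusin, if the union has positive measure in `K`, then `f` is continuous
on a compact `L` of positive measure. Split `L` by a Bernstein set: a compact subset of either half
has compact, hence countable, image, so it is null by the fibres; thus `L` is null. -/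

/-- A family of sets, each of them at least as large as the index type, has an injective choice
function. -/
theorem exists_injective_choice {ι : Type u} {X : Type v} (C : ι → Set X)
    (hC : ∀ i, Cardinal.lift.{v} (Cardinal.mk ι) ≤ Cardinal.lift.{u} (Cardinal.mk (C i))) :
    ∃ g : ι → X, Function.Injective g ∧ ∀ i, g i ∈ C i := by
  classical
  -- A well-order of minimal type: proper initial segments are smaller than `ι`, so they cannot
  -- exhaust `C i`.
  obtain ⟨_, _, hr⟩ := Cardinal.exists_ord_eq_type_lt ι
  have hfresh (i : ι) (p : ∀ j, j < i → X) :
      ∃ y ∈ C i, ∀ j (h : j < i), p j h ≠ y := by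
    by_contra! hcon
    have hsub : C i ⊆ range fun j : {j // j < i} => p j.1 j.2 := by
      intro y hy
      obtain ⟨j, h, hj⟩ := hcon y hy
      exact ⟨⟨j, h⟩, hj⟩
    have hlt : Cardinal.mk {j // j < i} < Cardinal.mk ι :=
      Cardinal.mk_Iio_lt i hr
    have hle := (Cardinal.lift_le.2 (Cardinal.mk_le_mk_of_subset hsub)).trans
      Cardinal.mk_range_le_lift
    exact absurd ((hC i).trans hle) (not_le.2 (Cardinal.lift_lt.2 hlt))
  choose! next hmem hne using hfresh
  let g : ι → X := (wellFounded_lt (α := ι)).fix next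
  have hg (i : ι) : g i = next i fun j _ => g j := (wellFounded_lt (α := ι)).fix_eq next i
  have hlt {i j : ι} (h : j < i) : g j ≠ g i := by
    rw [hg i]
    exact hne i (fun j _ => g j) j h
  refine ⟨g, fun i j hij => ?_, fun i => hg i ▸ hmem i _⟩
  rcases lt_trichotomy i j with h | h | h
  · exact absurd hij (hlt h)
  · exact h
  · exact absurd hij.symm (hlt h)

/-- An uncountable closed set of reals has the cardinality of the continuum. -/
theorem continuum_le_mk_of_isClosed {C : Set ℝ} (hC : IsClosed C) (hunc : ¬ C.Countable) :
    Cardinal.continuum ≤ Cardinal.mk C := by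
  obtain ⟨f, hfC, -, hf⟩ := hC.exists_nat_bool_injection_of_not_countable hunc
  have h := Cardinal.mk_le_of_injective
    (f := fun x => (⟨f x, hfC (mem_range_self x)⟩ : C)) fun x y hxy => hf (Subtype.ext_iff.1 hxy)
  simpa using h

/-- There are at most continuum many closed sets of reals. -/
theorem mk_isClosed_real_le_continuum :
    Cardinal.mk {C : Set ℝ // IsClosed C} ≤ Cardinal.continuum := by
  obtain ⟨b, hbc, -, hb⟩ := TopologicalSpace.exists_countable_basis ℝ
  have hborel : borel ℝ = MeasurableSpace.generateFrom b := hb.borel_eq_generateFrom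
  have hcard : Cardinal.mk b ≤ Cardinal.continuum :=
    (Cardinal.mk_le_aleph0_iff.2 hbc.to_subtype).trans Cardinal.aleph0_le_continuum
  refine le_trans (Cardinal.mk_le_of_injective (f := fun C : {C : Set ℝ // IsClosed C} =>
    (⟨C.1, ?_⟩ : {s : Set ℝ // MeasurableSet[MeasurableSpace.generateFrom b] s})) ?_)
    (MeasurableSpace.cardinal_measurableSet_le_continuum hcard)
  · rw [← hborel, ← BorelSpace.measurable_eq (α := ℝ)]
    exact C.2.measurableSet
  · intro C D h
    simpa [Subtype.ext_iff] using h

/-- There is a Bernstein set: every closed set of reals contained in it or in its complement is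
countable. -/
theorem exists_bernstein_set :
    ∃ B : Set ℝ, ∀ C : Set ℝ, IsClosed C → C ⊆ B ∨ C ⊆ Bᶜ → C.Countable := by
  let ι := {C : Set ℝ // IsClosed C ∧ ¬ C.Countable}
  have hι : Cardinal.mk (ι × Bool) ≤ Cardinal.continuum := by
    have h : Cardinal.mk ι ≤ Cardinal.continuum :=
      (Cardinal.mk_subtype_mono fun C hC => hC.1).trans mk_isClosed_real_le_continuum
    rw [Cardinal.mk_prod, Cardinal.lift_id, Cardinal.lift_id]
    refine Cardinal.mul_le_of_le Cardinal.aleph0_le_continuum h ?_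
    exact (Cardinal.mk_le_aleph0 (α := Bool)).trans Cardinal.aleph0_le_continuum
  -- Two points per uncountable closed set: `true` goes into the Bernstein set, `false` stays out.
  obtain ⟨g, hg, hgC⟩ := exists_injective_choice (fun i : ι × Bool => i.1.1) fun i => by
    simpa using hι.trans (continuum_le_mk_of_isClosed i.1.2.1 i.1.2.2)
  refine ⟨range fun C : ι => g (C, true), fun C hC hsub => ?_⟩
  by_contra hunc
  let c : ι := ⟨C, hC, hunc⟩
  rcases hsub with hsub | hsub
  · obtain ⟨d, hd⟩ := hsub (hgC (c, false))
    simpa using congrArg Prod.snd (hg hd)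
  · exact hsub (hgC (c, true)) ⟨c, rfl⟩

section FiniteMeasure

variable {X : Type*} [TopologicalSpace X] [T2Space X] [MeasurableSpace X] [BorelSpace X]
  {ν : Measure X} [IsFiniteMeasure ν] [ν.InnerRegularCompactLTTop]

theorem exists_isCompact_sdiff_lt_of_nullMeasurableSet {E : Set X} (hE : NullMeasurableSet E ν)
    {ε : ENNReal} (hε : ε ≠ 0) : ∃ K ⊆ E, IsCompact K ∧ ν (E \ K) < ε := by
  obtain ⟨T, hTE, hT, hae⟩ := hE.exists_measurable_subset_ae_eq
  obtain ⟨K, hKT, hK, -, hlt⟩ :=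
    hT.exists_isCompact_isClosed_sdiff_lt (measure_ne_top ν T) hε
  refine ⟨K, hKT.trans hTE, hK, ?_⟩
  rwa [← measure_congr (hae.diff (ae_eq_refl K))]

theorem exists_isCompact_measure_ne_zero {E : Set X} (hE : NullMeasurableSet E ν)
    (h : ν E ≠ 0) : ∃ K ⊆ E, IsCompact K ∧ ν K ≠ 0 := by
  obtain ⟨K, hKE, hK, hlt⟩ := exists_isCompact_sdiff_lt_of_nullMeasurableSet hE h
  refine ⟨K, hKE, hK, fun h0 => hlt.not_ge ?_⟩
  rw [measure_sdiff_null h0]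

/-- A form of Lusin's theorem: a real function that is measurable on a set of positive measure is
continuous on some compact subset of positive measure. -/
theorem exists_isCompact_continuousOn {E : Set X} {f : X → ℝ}
    (hf : ∀ V : Set ℝ, MeasurableSet V → NullMeasurableSet (E ∩ f ⁻¹' V) ν) (h : ν E ≠ 0) :
    ∃ L ⊆ E, IsCompact L ∧ ν L ≠ 0 ∧ ContinuousOn f L := by
  obtain ⟨δ, hδ, hsum⟩ := ENNReal.exists_pos_sum_of_countable' h (ℚ × Bool)
  let V : ℚ × Bool → Set ℝ := fun p => if p.2 then Iio (p.1 : ℝ) else Ici (p.1 : ℝ)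
  have hV (p) : MeasurableSet (V p) := by
    simp only [V]; split_ifs
    exacts [measurableSet_Iio, measurableSet_Ici]
  choose C hCE hC hCδ using fun p =>
    exists_isCompact_sdiff_lt_of_nullMeasurableSet (hf (V p) (hV p)) (hδ p).ne'
  have hlo (q : ℚ) {y : X} (hy : y ∈ C (q, true)) : f y < q := by
    simpa [V] using (hCE (q, true) hy).2
  have hhi (q : ℚ) {y : X} (hy : y ∈ C (q, false)) : (q : ℝ) ≤ f y := by
    simpa [V] using (hCE (q, false) hy).2
  -- On `L`, the cuts `f < q` and `q ≤ f` are traces of compact sets, hence relatively clopen.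
  let L : Set X := ⋂ q : ℚ, C (q, true) ∪ C (q, false)
  have hmemL {y : X} (hy : y ∈ L) (q : ℚ) : y ∈ C (q, true) ∨ y ∈ C (q, false) :=
    mem_iInter.1 hy q
  have hLE : L ⊆ E := fun y hy => (hmemL hy 0).elim (fun h => (hCE _ h).1) fun h => (hCE _ h).1
  have hLcl : IsClosed L := isClosed_iInter fun q => (hC _).isClosed.union (hC _).isClosed
  have hL : IsCompact L := ((hC (0, true)).union (hC (0, false))).of_isClosed_subset hLcl
    (iInter_subset _ 0)
  have hdiff : E \ L ⊆ ⋃ p, (E ∩ f ⁻¹' V p) \ C p := by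
    rintro y ⟨hyE, hyL⟩
    simp only [L, mem_iInter, not_forall, mem_union, not_or] at hyL
    obtain ⟨q, hq, hq'⟩ := hyL
    rcases lt_or_ge (f y) q with hlt | hge
    · exact mem_iUnion.2 ⟨(q, true), ⟨hyE, by simpa [V] using hlt⟩, hq⟩
    · exact mem_iUnion.2 ⟨(q, false), ⟨hyE, by simpa [V] using hge⟩, hq'⟩
  refine ⟨L, hLE, hL, fun h0 => ?_, fun x hx => tendsto_order.2 ⟨fun a ha => ?_, fun a ha => ?_⟩⟩
  · have hle : ν (E \ L) ≤ ∑' p, δ p :=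
      (measure_mono hdiff).trans <| (measure_iUnion_le _).trans <|
        ENNReal.tsum_le_tsum fun p => (hCδ p).le
    rw [measure_sdiff_null h0] at hle
    exact hle.not_gt hsum
  · obtain ⟨q, haq, hqx⟩ := exists_rat_btwn ha
    have hxq : x ∉ C (q, true) := fun hx => (hlo q hx).not_gt hqx
    filter_upwards [self_mem_nhdsWithin,
      mem_nhdsWithin_of_mem_nhds ((hC (q, true)).isClosed.isOpen_compl.mem_nhds hxq)] with y hy hyq
    exact haq.trans_le (hhi q ((hmemL hy q).resolve_left hyq))
  · obtain ⟨q, hxq, hqa⟩ := exists_rat_btwn ha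
    have hxq' : x ∉ C (q, false) := fun hx => (hhi q hx).not_gt hxq
    filter_upwards [self_mem_nhdsWithin,
      mem_nhdsWithin_of_mem_nhds ((hC (q, false)).isClosed.isOpen_compl.mem_nhds hxq')] with y hy hyq
    exact (hlo q ((hmemL hy q).resolve_right hyq)).trans hqa

/-- If the preimage in `E` of every set of reals is measurable and all fibres are null, then `E` is
null. -/
theorem measure_eq_zero_of_forall_preimage {E : Set X} {f : X → ℝ}
    (hf : ∀ V : Set ℝ, NullMeasurableSet (E ∩ f ⁻¹' V) ν)
    (h0 : ∀ r : ℝ, ν (E ∩ f ⁻¹' {r}) = 0) : ν E = 0 := by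
  by_contra hE
  obtain ⟨L, hLE, hL, hLpos, hcont⟩ := exists_isCompact_continuousOn (fun V _ => hf V) hE
  obtain ⟨B, hB⟩ := exists_bernstein_set
  have hnull (V : Set ℝ) (hV : ∀ C : Set ℝ, IsClosed C → C ⊆ V → C.Countable) :
      ν (L ∩ f ⁻¹' V) = 0 := by
    by_contra hpos
    have hmeas : NullMeasurableSet (L ∩ f ⁻¹' V) ν := by
      have h := hL.isClosed.nullMeasurableSet (μ := ν) |>.inter (hf V)
      rwa [← inter_assoc, inter_eq_left.2 hLE] at h
    obtain ⟨M, hMsub, hM, hMpos⟩ := exists_isCompact_measure_ne_zero hmeas hpos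
    have hcount : (f '' M).Countable :=
      hV _ (hM.image_of_continuousOn (hcont.mono fun x hx => (hMsub hx).1)).isClosed
        (image_subset_iff.2 fun x hx => (hMsub hx).2)
    refine hMpos (measure_mono_null (fun x hx => ?_) ((measure_biUnion_null_iff hcount).2
      fun r _ => h0 r))
    exact mem_biUnion (mem_image_of_mem f hx) ⟨hLE (hMsub hx).1, rfl⟩
  refine hLpos (measure_mono_null (fun x hx => ?_) (measure_union_null
    (hnull B fun C hC h => hB C hC (.inl h)) (hnull Bᶜ fun C hC h => hB C hC (.inr h))))
  by_cases hxB : f x ∈ B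
  · exact .inl ⟨hx, hxB⟩
  · exact .inr ⟨hx, hxB⟩

/-- The least element of a finite set `F x` of reals lies in `V` iff, for some rational `q`, the set
`F x` has exactly one element below `q`, and that element is in `V`. -/
theorem setOf_nonempty_inter_sInf_preimage {Y : Type*} {F : Y → Set ℝ}
    (hfin : ∀ x, (F x).Finite) (V : Set ℝ) :
    {x | (F x).Nonempty} ∩ (fun x => sInf (F x)) ⁻¹' V =
      ⋃ q : ℚ, {x | (F x ∩ (V ∩ Iio (q : ℝ))).Nonempty} \
        ⋃ r : ℚ, {x | (F x ∩ Iio (r : ℝ)).Nonempty} ∩ {x | (F x ∩ Ico (r : ℝ) q).Nonempty} := by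
  ext x
  simp only [mem_inter_iff, mem_ofPred_eq, mem_preimage, mem_iUnion, mem_sdiff, not_exists, not_and]
  constructor
  · rintro ⟨hne, hV⟩
    have hmem := hne.csInf_mem (hfin x)
    set m := sInf (F x)
    have hnhds : (F x \ {m})ᶜ ∈ nhds m :=
      ((hfin x).subset sdiff_subset).isClosed.isOpen_compl.mem_nhds (by simp)
    -- By finiteness some `u > m` has no other element of `F x` below it.
    obtain ⟨u, hmu, hu⟩ := exists_Ico_subset_of_mem_nhds hnhds (exists_gt m)
    obtain ⟨q, hmq, hqu⟩ := exists_rat_btwn hmu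
    refine ⟨q, ⟨m, hmem, hV, hmq⟩, ?_⟩
    rintro r ⟨t, htF, htr⟩ ⟨s, hsF, hrs, hsq⟩
    have hmt : m ≤ t := csInf_le (hfin x).bddBelow htF
    have hms : m < s := hmt.trans_lt (lt_of_lt_of_le htr hrs)
    exact hu ⟨hms.le, lt_trans hsq hqu⟩ ⟨hsF, hms.ne'⟩
  · rintro ⟨q, ⟨s, hsF, hsV, hsq⟩, hq⟩
    have hne : (F x).Nonempty := ⟨s, hsF⟩
    refine ⟨hne, ?_⟩
    have hmem := hne.csInf_mem (hfin x)
    rcases (csInf_le (hfin x).bddBelow hsF).eq_or_lt with heq | hlt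
    · rwa [heq]
    · obtain ⟨r, hr, hrs⟩ := exists_rat_btwn hlt
      exact (hq r ⟨_, hmem, hr⟩ ⟨s, hsF, hrs.le, hsq⟩).elim

/-- A finite-set-valued map into the reals is empty almost everywhere, if each set of reals is hit
on a measurable set and each single real is hit on a null set. -/
theorem measure_setOf_nonempty_eq_zero {F : X → Set ℝ} (hfin : ∀ x, (F x).Finite)
    (hmeas : ∀ V : Set ℝ, NullMeasurableSet {x | (F x ∩ V).Nonempty} ν)
    (h0 : ∀ r : ℝ, ν {x | r ∈ F x} = 0) : ν {x | (F x).Nonempty} = 0 := by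
  -- Restricting to nonempty `F x` keeps out the default `sInf ∅ = 0`.
  refine measure_eq_zero_of_forall_preimage (f := fun x => sInf (F x)) (fun V => ?_) fun r => ?_
  · rw [setOf_nonempty_inter_sInf_preimage hfin]
    exact .iUnion fun q => (hmeas _).diff (.iUnion fun r => (hmeas _).inter (hmeas _))
  · refine measure_mono_null ?_ (h0 r)
    rintro x ⟨hne, rfl⟩
    exact Set.Nonempty.csInf_mem hne (hfin x)

end FiniteMeasure

/-- Testing on the measurable hull of `A` and cancelling the finite `ν A` shows that the hull
exceeds `A` by a null set. -/
theorem nullMeasurableSet_of_isCaratheodory {X : Type*} [MeasurableSpace X] {ν : Measure X}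
    [IsFiniteMeasure ν] {A : Set X} (hA : ν.toOuterMeasure.IsCaratheodory A) :
    NullMeasurableSet A ν := by
  have h := hA (toMeasurable ν A)
  simp only [Measure.coe_toOuterMeasure] at h
  rw [inter_eq_right.2 (subset_toMeasurable ν A), measure_toMeasurable] at h
  have h0 : ν (toMeasurable ν A \ A) = 0 := by
    have h' : ν A + 0 = ν A + ν (toMeasurable ν A \ A) := by rwa [add_zero]
    exact ((ENNReal.add_right_inj (measure_ne_top ν A)).1 h').symm
  refine (measurableSet_toMeasurable ν A).nullMeasurableSet.congr ?_
  exact (ae_le_set.2 h0).antisymm (subset_toMeasurable ν A).eventuallyLE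

theorem IsHaarMeasurable.nullMeasurableSet_restrict {X : Type*} [MeasurableSpace X] {μ : Measure X}
    {A K : Set X} (hA : IsHaarMeasurable μ A) (hK : MeasurableSet K) (hKfin : μ K ≠ ⊤) :
    NullMeasurableSet A (μ.restrict K) := by
  have : IsFiniteMeasure (μ.restrict K) := isFiniteMeasure_restrict.2 hKfin
  refine nullMeasurableSet_of_isCaratheodory fun t => ?_
  have h := hA (t ∩ K)
  simp only [Measure.coe_toOuterMeasure, Measure.restrict_apply' hK] at h ⊢
  rwa [inter_right_comm, inter_sdiff_right_comm] at h

theorem mainTheorem2 {G : Type*} [Group G] [TopologicalSpace G] [IsTopologicalGroup G]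
    [LocallyCompactSpace G] [T2Space G] [MeasurableSpace G] [BorelSpace G]
    (μ : MeasureTheory.Measure G) [μ.IsHaarMeasure] [μ.InnerRegularCompactLTTop]
    (𝒜 : Set (Set G)) (hfin : IsPointFinite 𝒜)
    (hnull : ∀ A ∈ 𝒜, IsLocallyNull μ A)
    (hcard : Cardinal.mk 𝒜 ≤ Cardinal.continuum)
    (hunion : ¬ IsLocallyNull μ (⋃₀ 𝒜)) :
    ∃ ℬ ⊆ 𝒜, ¬ IsHaarMeasurable μ (⋃₀ ℬ) := by
  by_contra! hmeas
  refine hunion fun K hK => ?_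
  have hKm : MeasurableSet K := hK.isClosed.measurableSet
  have hKfin : μ K ≠ ⊤ := hK.measure_ne_top
  have : IsFiniteMeasure (μ.restrict K) := isFiniteMeasure_restrict.2 hKfin
  obtain ⟨e⟩ : Nonempty (𝒜 ↪ ℝ) := by
    rw [← Cardinal.lift_mk_le', Cardinal.mk_real, Cardinal.lift_continuum]
    simpa using hcard
  let F : G → Set ℝ := fun x => e '' {A : 𝒜 | x ∈ A.1}
  have hFfin (x : G) : (F x).Finite := by
    refine Finite.image _ (Finite.of_finite_image ((hfin x).subset ?_)
      Subtype.val_injective.injOn)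
    rintro _ ⟨A, hxA, rfl⟩
    exact ⟨A.2, hxA⟩
  have hzero : μ.restrict K {x | (F x).Nonempty} = 0 := by
    refine measure_setOf_nonempty_eq_zero hFfin (fun V => ?_) fun r => ?_
    · have hV : {x | (F x ∩ V).Nonempty} = ⋃₀ (Subtype.val '' (e ⁻¹' V)) := by
        ext x
        constructor
        · rintro ⟨_, ⟨A, hxA, rfl⟩, hAV⟩
          exact ⟨A, mem_image_of_mem _ hAV, hxA⟩
        · rintro ⟨_, ⟨A, hAV, rfl⟩, hxA⟩
          exact ⟨e A, mem_image_of_mem e hxA, hAV⟩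
      rw [hV]
      exact (hmeas _ (Subtype.coe_image_subset _ _)).nullMeasurableSet_restrict hKm hKfin
    · by_cases hr : ∃ A, e A = r
      · obtain ⟨A, rfl⟩ := hr
        rw [Measure.restrict_apply' hKm]
        refine measure_mono_null (inter_subset_inter_left K ?_) (hnull A A.2 K hK)
        rintro x ⟨A', hxA', hA'⟩
        exact e.injective hA' ▸ hxA'
      · convert measure_empty (μ := μ.restrict K)
        refine eq_empty_of_forall_notMem fun x hx => ?_
        obtain ⟨A, -, hA⟩ := hx
        exact hr ⟨A, hA⟩
  rw [Measure.restrict_apply' hKm] at hzero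
  refine measure_mono_null (inter_subset_inter_left K ?_) hzero
  rintro x ⟨A, hA, hxA⟩
  exact ⟨e ⟨A, hA⟩, ⟨A, hA⟩, hxA, rfl⟩
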